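/- Let $\alpha=(\sqrt5-1)/2$, let $g(x)=\cot(\pi x)$, let $g^{(l)}$ denote the $l$-th derivative of $g$, and let $q_n$ be the $n$-th Fibonacci number ($q_0=0$, $q_1=q_2=1$, $q_{n+2}=q_{n+1}+q_n$). For $l\ge 0$, $n\ge 1$ and real $y$ put $$\sigma_n(y)=\frac1{q_n}\sum_{k=1}^{q_n-1} g\Big(\frac{y}{q_n}+k\alpha\Big),\qquad \sigma_{n}^{[l]}(y)=\frac1{q_n^{\,l+1}}\sum_{k=1}^{q_n-1} g^{(l)}\Big(\frac{y}{q_n}+k\alpha\Big).$$ Then there is $r>0$ such that for $|y|<r$ none of the points $y/q_n+k\alpha$ ($n\ge1$, $1\le k<q_n$) is an integer (so all sums are defined), and the following holds. (1) For all $|y|<r$ the limits along the even and along the odd indices, $$\sigma^{\mathrm{ev}}(y)=\lim_{n\to\infty}\sigma_{2n}(y),\qquad \sigma^{\mathrm{odd}}(y)=\lim_{n\to\infty}\sigma_{2n+1}(y),$$ exist, and $\sigma^{\mathrm{odd}}(y)=-\sigma^{\mathrm{ev}}(-y)$. (2) Both functions are real-analytic on $(-r,r)$. For either one, write $\sigma$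 for it. For every $l\ge0$ and $|y|<r$ the limit of $\sigma_n^{[l]}(y)$ along the indices $n$ of the corresponding parity exists and equals the $l$-th derivative $\sigma^{(l)}(y)$. In particular the limits $$a_l=\lim_{n}\frac1{q_n^{\,l+1}}\sum_{k=1}^{q_n-1} g^{(l)}(k\alpha)$$ along these $n$ exist, and $\sigma(y)=\sum_{l=0}^\infty a_l\,y^l/l!$ for all $|y|<r$. -/

import Mathlib

open Filter Topology

namespace GoldenCot

noncomputable section

/-- The golden rotation number `α = (√5 - 1) / 2`. -/
def alpha : ℝ := (Real.sqrt 5 - 1) / 2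

/-- The function `g(x) = cot(π x)`. -/
def g (x : ℝ) : ℝ := Real.cot (Real.pi * x)

/-- The Fibonacci denominators `q_1 = 1, q_2 = 1, q_3 = 2, …` of the convergents of `alpha`. -/
def q (n : ℕ) : ℕ := Nat.fib n

/-- `σ_n(y) = (1 / q_n) ∑_{k = 1}^{q_n - 1} g(y / q_n + k α)`. -/
def sigmaN (n : ℕ) (y : ℝ) : ℝ :=
  (1 / (q n : ℝ)) * ∑ k ∈ Finset.Ico 1 (q n), g (y / q n + k * alpha)

/-- `(1 / q_n ^ (l + 1)) ∑_{k = 1}^{q_n - 1} g^{(l)}(y / q_n + k α)`. -/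
def sigmaDerivN (l n : ℕ) (y : ℝ) : ℝ :=
  (1 / (q n : ℝ) ^ (l + 1)) *
    ∑ k ∈ Finset.Ico 1 (q n), iteratedDeriv l g (y / q n + k * alpha)

end

end GoldenCot

/-! Since `q n * alpha` differs from the integer `num n` by `goldenConj ^ n`, the point z/q + kα is,
modulo 1, equal to (z - k * goldenConj ^ n + j)/q with j ≡ k * num n mod q. By Binet's formula the
shift k * goldenConj ^ n has modulus at most 31/50 for 0 ≤ k ≤ q, so for |z| < 1/10 the numerator
stays away from 0 whenever j ≠ 0.

Cassini's identity inverts `num n` modulo q, so k/q is the fractional part of (-1)^n * j * num n /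
q. Along one parity it tends to fract(±jα), and the shift converges as well. Each term cot(π·)/q
thus tends to a simple fraction of size about 1/|j|. Pairing j with -j gives terms O(1/j²) uniformly
in n and z, and dominated convergence yields the limit (`tendsto_sigmaC`).

All this holds on a complex disc, where the sums are holomorphic and eventually uniformly bounded.
Convergence is therefore locally uniform and passes to all derivatives; restriction to the real line
gives the claims on derivatives and Taylor coefficients. The relation between the two parities is a
termwise symmetry of the limit series (`limitC_neg`). -/

namespace GoldenCot

/-! ### Convergence of holomorphic functions and restriction to the real line -/

/-- A pointwise convergent, uniformly bounded sequence of holomorphic functions converges locally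
uniformly. -/
theorem tendstoLocallyUniformlyOn_of_bounded {F : ℕ → ℂ → ℂ} {f : ℂ → ℂ} {U : Set ℂ} {M : ℝ}
    (hU : IsOpen U) (hF : ∀ n, DifferentiableOn ℂ (F n) U)
    (hM : ∀ᶠ n in atTop, ∀ z ∈ U, ‖F n z‖ ≤ M)
    (hf : ∀ z ∈ U, Tendsto (fun n => F n z) atTop (𝓝 (f z))) :
    TendstoLocallyUniformlyOn F f atTop U := by
  rw [Metric.tendstoLocallyUniformlyOn_iff]
  intro ε hε z hz
  obtain ⟨δ, hδ, hball⟩ := Metric.isOpen_iff.1 hU z hz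
  have hM0 : 0 ≤ M := by
    obtain ⟨n, hn⟩ := hM.exists
    exact (norm_nonneg _).trans (hn z hz)
  -- Schwarz's lemma makes the family equi-Lipschitz near z. The bound 2M would do; the +1 keeps the
  -- constant positive when M = 0.
  have hlip : ∀ᶠ n in atTop, ∀ w ∈ Metric.ball z δ,
      dist (F n w) (F n z) ≤ (2 * M + 1) / δ * dist w z := by
    filter_upwards [hM] with n hn w hw
    refine Complex.dist_le_div_mul_dist_of_mapsTo_ball ((hF n).mono hball) ?_ hw
    intro x hx
    have h1 := hn x (hball hx)
    have h2 := hn z hz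
    rw [mem_closedBall_iff_norm]
    linarith [norm_sub_le (F n x) (F n z)]
  have hlipf : ∀ w ∈ Metric.ball z δ, dist (f w) (f z) ≤ (2 * M + 1) / δ * dist w z := by
    intro w hw
    refine le_of_tendsto ((hf w (hball hw)).dist (hf z hz)) ?_
    filter_upwards [hlip] with n hn using hn w hw
  have hc : 0 < (2 * M + 1) / δ := by positivity
  refine ⟨Metric.ball z (min δ (ε / 3 / ((2 * M + 1) / δ))),
    mem_nhdsWithin_of_mem_nhds (Metric.ball_mem_nhds _ (by positivity)), ?_⟩
  filter_upwards [hlip, Metric.tendsto_nhds.1 (hf z hz) (ε / 3) (by positivity)] with n h1 h2 w hw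
  have hwδ : w ∈ Metric.ball z δ := Metric.ball_subset_ball (min_le_left _ _) hw
  have hwε : (2 * M + 1) / δ * dist w z < ε / 3 := by
    rw [mul_comm, ← lt_div_iff₀ hc]
    exact (Metric.mem_ball.1 hw).trans_le (min_le_right _ _)
  have h3 := h1 w hwδ
  have h4 := hlipf w hwδ
  have h5 := dist_triangle4 (f w) (f z) (F n z) (F n w)
  rw [dist_comm (f z) (F n z), dist_comm (F n z) (F n w)] at h5
  linarith

theorem tendstoLocallyUniformlyOn_iteratedDeriv {F : ℕ → ℂ → ℂ} {f : ℂ → ℂ} {U : Set ℂ}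
    (hU : IsOpen U) (hF : ∀ n, DifferentiableOn ℂ (F n) U)
    (hf : TendstoLocallyUniformlyOn F f atTop U) (l : ℕ) :
    TendstoLocallyUniformlyOn (fun n => iteratedDeriv l (F n)) (iteratedDeriv l f) atTop U := by
  induction l generalizing F f with
  | zero => simpa [iteratedDeriv_zero] using hf
  | succ l ih =>
    simp only [iteratedDeriv_succ']
    exact ih (fun n => (hF n).deriv hU) (hf.deriv (Eventually.of_forall hF) hU)

/-- The derivatives of a holomorphic extension restrict to the derivatives of the real function. -/
theorem iteratedDeriv_ofReal_eq {F : ℂ → ℂ} {f : ℝ → ℝ} {U : Set ℂ} (hU : IsOpen U)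
    (hF : DifferentiableOn ℂ F U) (h : ∀ x : ℝ, (x : ℂ) ∈ U → F x = f x) (l : ℕ) :
    ∀ x : ℝ, (x : ℂ) ∈ U → iteratedDeriv l F x = (iteratedDeriv l f x : ℝ) := by
  induction l generalizing F f with
  | zero => simpa [iteratedDeriv_zero] using h
  | succ l ih =>
    simp only [iteratedDeriv_succ']
    refine ih (hF.deriv hU) fun x hx => ?_
    have hd : HasDerivAt F (deriv F x) x := (hF.differentiableAt (hU.mem_nhds hx)).hasDerivAt
    have hev : ∀ᶠ y : ℝ in 𝓝 x, (y : ℂ) ∈ U :=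
      Complex.continuous_ofReal.continuousAt.eventually (hU.mem_nhds hx)
    have h1 : HasDerivAt (fun y : ℝ => (f y : ℂ)) (deriv F x) x :=
      hd.comp_ofReal.congr_of_eventuallyEq (hev.mono fun y hy => (h y hy).symm)
    have h2 : HasDerivAt f (deriv F x).re x :=
      hd.real_of_complex.congr_of_eventuallyEq (hev.mono fun y hy => by simp [h y hy])
    rw [h2.deriv]
    exact h1.unique (h2.deriv ▸ h2.ofReal_comp)

theorem iteratedDeriv_comp_mul_add (f : ℝ → ℝ) (c b : ℝ) (l : ℕ) (x : ℝ) :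
    iteratedDeriv l (fun y => f (c * y + b)) x = c ^ l * iteratedDeriv l f (c * x + b) := by
  induction l generalizing f with
  | zero => simp
  | succ l ih =>
    have hd : deriv (fun y => f (c * y + b)) = c • fun y => deriv f (c * y + b) := by
      funext y
      have := deriv_comp_mul_left c (fun t => f (t + b)) y
      rw [deriv_comp_add_const] at this
      simpa using this
    rw [iteratedDeriv_succ', iteratedDeriv_succ', hd, iteratedDeriv_const_smul_field, ih]
    rw [smul_eq_mul]; ring

/-! ### Estimates for sine and cotangent -/

theorem abs_sin_re_le_norm_sin (z : ℂ) : |Real.sin z.re| ≤ ‖Complex.sin z‖ := by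
  have h : (Complex.sin z).re = Real.sin z.re * Real.cosh z.im := by
    rw [Complex.sin_eq]
    simp [← Complex.ofReal_sin, ← Complex.ofReal_cos, ← Complex.ofReal_cosh, ← Complex.ofReal_sinh]
  refine le_trans ?_ (Complex.abs_re_le_norm _)
  rw [h, abs_mul]
  exact le_mul_of_one_le_right (abs_nonneg _) ((Real.one_le_cosh _).trans (le_abs_self _))

theorem norm_sin_le_two_mul {w : ℂ} (hw : ‖w‖ ≤ 1) : ‖Complex.sin w‖ ≤ 2 * ‖w‖ := by
  have h1 := Complex.norm_exp_sub_one_le (x := w * Complex.I) (by simpa using hw)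
  have h2 := Complex.norm_exp_sub_one_le (x := -w * Complex.I) (by simpa using hw)
  simp only [norm_mul, norm_neg, Complex.norm_I, mul_one] at h1 h2
  have : Complex.sin w = ((Complex.exp (-w * Complex.I) - 1) - (Complex.exp (w * Complex.I) - 1))
      * Complex.I / 2 := by
    rw [Complex.sin]; ring
  rw [this, norm_div, norm_mul, Complex.norm_I, mul_one]
  have := norm_sub_le (Complex.exp (-w * Complex.I) - 1) (Complex.exp (w * Complex.I) - 1)
  have h2' : ‖(2 : ℂ)‖ = 2 := by simp
  rw [h2']
  linarith

theorem abs_le_abs_sin_pi_mul {x : ℝ} (hx : |x| ≤ 3 / 4) : 2 / 3 * |x| ≤ |Real.sin (Real.pi * x)| := by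
  wlog h0 : 0 ≤ x generalizing x
  · have := this (x := -x) (by rwa [abs_neg]) (by linarith)
    simpa using this
  rw [abs_of_nonneg h0] at hx ⊢
  refine le_trans ?_ (le_abs_self _)
  have hpi := Real.pi_pos
  by_cases h : x ≤ 1 / 2
  · have := Real.mul_le_sin (x := Real.pi * x) (by positivity) (by nlinarith)
    have h2 : 2 / Real.pi * (Real.pi * x) = 2 * x := by field_simp
    linarith
  -- Past 1/2, reflection gives the lower bound 2(1 - x), which is at least 2x/3 exactly when x ≤
  -- 3/4.
  · have := Real.mul_le_sin (x := Real.pi * (1 - x)) (by nlinarith) (by nlinarith)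
    have h2 : 2 / Real.pi * (Real.pi * (1 - x)) = 2 * (1 - x) := by field_simp
    have h3 : Real.sin (Real.pi * (1 - x)) = Real.sin (Real.pi * x) := by
      rw [mul_sub, mul_one, Real.sin_pi_sub]
    linarith

theorem norm_sin_lower {q : ℝ} (hq : 10 ≤ q) {j : ℤ} (hj : j ≠ 0) (hjq : 2 * |(j : ℝ)| ≤ q)
    {e : ℂ} (he : ‖e‖ ≤ 18 / 25) :
    1 / 6 * (|(j : ℝ)| / q) ≤ ‖Complex.sin (Real.pi * ((e + j) / q))‖ := by
  have hq0 : 0 < q := by linarith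
  have hj1 : (1 : ℝ) ≤ |(j : ℝ)| := by exact_mod_cast Int.one_le_abs hj
  have hre : (Real.pi * ((e + j) / q) : ℂ).re = Real.pi * ((e.re + j) / q) := by
    rw [Complex.re_ofReal_mul, Complex.div_ofReal_re]; simp
  refine le_trans ?_ (abs_sin_re_le_norm_sin _)
  rw [hre]
  have her : |e.re| ≤ 18 / 25 := (Complex.abs_re_le_norm e).trans he
  have h1 : |e.re + j| ≤ |e.re| + |(j : ℝ)| := abs_add_le _ _
  have h2 : |(j : ℝ)| ≤ |e.re + j| + |e.re| := by
    have := abs_sub (e.re + j) e.re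
    simpa using this
  refine le_trans ?_ (abs_le_abs_sin_pi_mul ?_)
  -- As |j| ≥ 1, 2/3 * (|j| - 18/25) ≥ |j|/6.
  · rw [abs_div, abs_of_pos hq0, ← mul_div_assoc, ← mul_div_assoc]
    exact div_le_div_of_nonneg_right (by linarith) hq0.le
  · rw [abs_div, abs_of_pos hq0, div_le_iff₀ hq0]
    linarith

/-- cot A + cot B = sin(A + B)/(sin A sin B). In A + B the integer j cancels, so the numerator is
O(1/q), while each sine is at least |j|/(6q). The two shifts e and e' need not be related. -/
theorem norm_cot_add_cot_le {q : ℝ} (hq : 10 ≤ q) {j : ℤ} (hj : j ≠ 0) (hjq : 2 * |(j : ℝ)| ≤ q)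
    {e e' : ℂ} (he : ‖e‖ ≤ 18 / 25) (he' : ‖e'‖ ≤ 18 / 25) :
    ‖1 / (q : ℂ) * (Complex.cot (Real.pi * ((e + j) / q)) +
      Complex.cot (Real.pi * ((e' + (-j : ℤ)) / q)))‖ ≤ 1000 * (1 / (j : ℝ) ^ 2) := by
  have hq0 : 0 < q := by linarith
  have hj1 : (1 : ℝ) ≤ |(j : ℝ)| := by exact_mod_cast Int.one_le_abs hj
  have hA := norm_sin_lower hq hj hjq he
  have hB := norm_sin_lower hq (j := -j) (by simpa using hj) (by simpa using hjq) he'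
  rw [Int.cast_neg (R := ℝ), abs_neg] at hB
  set A : ℂ := Real.pi * ((e + j) / q) with hAdef
  set B : ℂ := Real.pi * ((e' + (-j : ℤ)) / q) with hBdef
  have hpos : 0 < 1 / 6 * (|(j : ℝ)| / q) := by positivity
  have hA0 : Complex.sin A ≠ 0 := norm_pos_iff.1 (hpos.trans_le hA)
  have hB0 : Complex.sin B ≠ 0 := norm_pos_iff.1 (hpos.trans_le hB)
  have hsum : Complex.cot A + Complex.cot B =
      Complex.sin (A + B) / (Complex.sin A * Complex.sin B) := by
    rw [Complex.cot_eq_cos_div_sin, Complex.cot_eq_cos_div_sin, Complex.sin_add]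
    field_simp
    ring
  have hAB : A + B = Real.pi * ((e + e') / q) := by
    rw [hAdef, hBdef]; push_cast; ring
  have hnAB : ‖A + B‖ ≤ 5 / q := by
    rw [hAB, norm_mul, norm_div, Complex.norm_real, Complex.norm_real, Real.norm_of_nonneg
      Real.pi_pos.le, Real.norm_of_nonneg hq0.le, ← mul_div_assoc]
    gcongr
    have h1 := norm_add_le e e'
    have h2 := Real.pi_lt_d2
    have h3 := Real.pi_pos
    nlinarith [norm_nonneg (e + e')]
  have hs := norm_sin_le_two_mul (w := A + B) (hnAB.trans (by rw [div_le_one hq0]; linarith))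
  rw [hsum, norm_mul, norm_div, norm_div, norm_mul, norm_one, Complex.norm_real,
    Real.norm_of_nonneg hq0.le]
  calc 1 / q * (‖Complex.sin (A + B)‖ / (‖Complex.sin A‖ * ‖Complex.sin B‖))
      ≤ 1 / q * ((2 * (5 / q)) / ((1 / 6 * (|(j : ℝ)| / q)) * (1 / 6 * (|(j : ℝ)| / q)))) := by
        gcongr
        linarith
    _ = 360 * (1 / (j : ℝ) ^ 2) := by
        rw [← sq_abs (j : ℝ)]
        have : |(j : ℝ)| ≠ 0 := by positivity
        field_simp
        norm_num
    _ ≤ 1000 * (1 / (j : ℝ) ^ 2) := by gcongr; norm_num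

/-- `cot (π w / q) / q → 1 / (π w)` as `q → ∞`. -/
theorem tendsto_cot_div {q : ℕ → ℝ} (hq : Tendsto q atTop atTop) {w : ℕ → ℂ} {w₀ : ℂ}
    (hw : Tendsto w atTop (𝓝 w₀)) (hw₀ : w₀ ≠ 0) :
    Tendsto (fun n => 1 / (q n : ℂ) * Complex.cot (Real.pi * (w n / q n))) atTop
      (𝓝 (1 / (Real.pi * w₀))) := by
  have hqc : Tendsto (fun n => ((q n)⁻¹ : ℂ)) atTop (𝓝 0) := by
    have := (Complex.continuous_ofReal.tendsto 0).comp (tendsto_inv_atTop_zero.comp hq)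
    simpa [Function.comp_def] using this
  have ht : Tendsto (fun n => (Real.pi * (w n / q n) : ℂ)) atTop (𝓝 0) := by
    have := (hw.mul hqc).const_mul (Real.pi : ℂ)
    simpa [div_eq_mul_inv] using this
  have hcos : Tendsto (fun n => Complex.cos (Real.pi * (w n / q n))) atTop (𝓝 1) := by
    have := (Complex.continuous_cos.tendsto 0).comp ht
    simpa [Function.comp_def] using this
  have hπ : (Real.pi : ℂ) ≠ 0 := by exact_mod_cast Real.pi_ne_zero
  -- `dslope` extends sin t / t continuously by 1 at t = 0.
  have hdsl : Tendsto (fun n => dslope Complex.sin 0 (Real.pi * (w n / q n))) atTop (𝓝 1) := by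
    have hc : ContinuousAt (dslope Complex.sin 0) 0 :=
      continuousAt_dslope_same.2 Complex.differentiable_sin.differentiableAt
    have := hc.tendsto.comp ht
    simpa [Function.comp_def, dslope_same] using this
  have hden : Tendsto (fun n => Real.pi * w n * dslope Complex.sin 0 (Real.pi * (w n / q n)))
      atTop (𝓝 (Real.pi * w₀)) := by
    simpa using (hw.const_mul (Real.pi : ℂ)).mul hdsl
  refine (hcos.div hden (mul_ne_zero hπ hw₀)).congr' ?_
  filter_upwards [hq.eventually_gt_atTop 0, hw.eventually_ne hw₀] with n hn hwn
  have hqn : (q n : ℂ) ≠ 0 := by exact_mod_cast hn.ne'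
  have harg : (Real.pi * (w n / q n) : ℂ) ≠ 0 := mul_ne_zero hπ (div_ne_zero hwn hqn)
  have hsin : (q n : ℂ) * Complex.sin (Real.pi * (w n / q n)) =
      Real.pi * w n * dslope Complex.sin 0 (Real.pi * (w n / q n)) := by
    rw [dslope_of_ne _ harg, slope_def_field]
    simp only [Complex.sin_zero, sub_zero]
    field_simp
  rw [Pi.div_apply, ← hsin, Complex.cot_eq_cos_div_sin, div_mul_div_comm, one_mul]

/-! ### Arithmetic of the convergents and the size of the shift -/

open Real in
theorem goldenConj_eq_neg_alpha : goldenConj = -alpha := by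
  rw [goldenConj, alpha]; ring

theorem alpha_irrational : Irrational alpha := by
  have := Real.goldenConj_irrational.neg
  rwa [goldenConj_eq_neg_alpha, neg_neg] at this

/-- The numerators of the convergents of `alpha`. -/
def num (n : ℕ) : ℤ := Nat.fib (n + 1) - Nat.fib n

theorem q_mul_alpha (n : ℕ) : (q n : ℝ) * alpha = num n - Real.goldenConj ^ n := by
  have h1 := Real.fib_succ_sub_goldenRatio_mul_fib n
  have h2 : Real.goldenRatio = 1 + alpha := by
    have := Real.goldenRatio_add_goldenConj
    rw [goldenConj_eq_neg_alpha] at this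
    linarith
  rw [← h1, h2, num, q]
  push_cast
  ring

theorem fib_cassini (n : ℕ) : (Nat.fib (n + 1) : ℤ) ^ 2 - Nat.fib (n + 1) * Nat.fib n -
    (Nat.fib n : ℤ) ^ 2 = (-1) ^ n := by
  induction n with
  | zero => simp
  | succ n ih =>
    rw [Nat.fib_add_two, pow_succ (-1 : ℤ), ← ih]
    push_cast
    ring

/-- Cassini's identity modulo `q n` says that the square of `num n` is (-1)^n, which makes the
inverse of `num n` explicit. -/
theorem num_mul_num_modEq (n : ℕ) : (-1) ^ n * num n * num n ≡ 1 [ZMOD q n] := by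
  have h : (1 : ℤ) - (-1) ^ n * num n * num n =
      q n * ((-1) ^ n * (Nat.fib (n + 1) - 2 * Nat.fib n)) := by
    have h1 : (-1 : ℤ) ^ n * (-1) ^ n = 1 := by rw [← mul_pow]; simp
    have := fib_cassini n
    rw [num, q]
    linear_combination (-1 : ℤ) * h1 - (-1) ^ n * this
  exact (Int.modEq_iff_dvd.2 (h ▸ dvd_mul_right _ _))

theorem isCoprime_num (n : ℕ) : IsCoprime ((-1) ^ n * num n) (q n : ℤ) := by
  obtain ⟨t, ht⟩ := Int.modEq_iff_dvd.1 (num_mul_num_modEq n)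
  exact ⟨num n, t, by linarith⟩

/-- The nonzero integers in `(-q / 2, q / 2]`. -/
noncomputable def residues (q : ℕ) : Finset ℤ := (Finset.Ioc ((q : ℤ) / 2 - q) ((q : ℤ) / 2)).erase 0

/-- Multiplication by a unit c permutes the nonzero classes modulo q, and both index sets represent
each of these classes once. -/
theorem sum_residues {q : ℕ} (hq : 0 < q) {c : ℤ} (hc : IsCoprime c (q : ℤ)) (h : ℤ → ℂ) :
    ∑ j ∈ residues q, h ((c * j) % q) = ∑ k ∈ Finset.Ico 1 q, h k := by
  have hmod0 (j : ℤ) : 0 ≤ (c * j) % q := Int.emod_nonneg _ (by omega)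
  have hmodq (j : ℤ) : (c * j) % q < q := Int.emod_lt_of_pos _ (by omega)
  have hinj : Set.InjOn (fun j : ℤ => ((c * j) % q).toNat) (residues q) := by
    intro a ha b hb hab
    simp only [residues, Finset.coe_erase, Finset.coe_Ioc, Set.mem_sdiff, Set.mem_Ioc,
      Set.mem_singleton_iff] at ha hb
    have h1 : (c * a) % q = (c * b) % q := by
      have := hmod0 a
      have := hmod0 b
      simp only at hab
      omega
    have h2 : (q : ℤ) ∣ c * (a - b) := by
      rw [mul_sub]; exact Int.ModEq.dvd (Eq.symm h1)
    have h3 : (q : ℤ) ∣ a - b := hc.symm.dvd_of_dvd_mul_left h2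
    have := Int.eq_zero_of_abs_lt_dvd h3 (by rw [abs_lt]; omega)
    omega
  have hmaps : Set.MapsTo (fun j : ℤ => ((c * j) % q).toNat) (residues q)
      (Finset.Ico 1 q : Finset ℕ) := by
    intro a ha
    simp only [residues, Finset.coe_erase, Finset.coe_Ioc, Set.mem_sdiff, Set.mem_Ioc,
      Set.mem_singleton_iff] at ha
    have h0 : (c * a) % q ≠ 0 := fun h0 => by
      have h3 : (q : ℤ) ∣ a := hc.symm.dvd_of_dvd_mul_left (Int.dvd_of_emod_eq_zero h0)
      exact ha.2 (Int.eq_zero_of_abs_lt_dvd h3 (by rw [abs_lt]; omega))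
    have h1 := hmod0 a
    have h2 := hmodq a
    simp only [Finset.coe_Ico, Set.mem_Ico]
    omega
  have hcard : (Finset.Ico 1 q).card ≤ (residues q).card := by
    rw [residues, Finset.card_erase_of_mem (by rw [Finset.mem_Ioc]; omega)]
    simp
  refine Finset.sum_nbij (fun j : ℤ => ((c * j) % q).toNat) (fun j hj => hmaps hj) hinj
    (Finset.surjOn_of_injOn_of_card_le _ hmaps hinj hcard) fun j _ => ?_
  congr 1
  have := hmod0 j
  omega

theorem cot_pi_mul_add_int (x : ℂ) (t : ℤ) :
    Complex.cot (Real.pi * (x + t)) = Complex.cot (Real.pi * x) := by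
  have := Complex.tan_periodic.int_mul t (Real.pi * x)
  rw [← Complex.tan_inv_eq_cot, ← Complex.tan_inv_eq_cot, mul_add, mul_comm (Real.pi : ℂ) (t : ℂ),
    this]

theorem arg_eq_of_modEq {n : ℕ} (hq : q n ≠ 0) {j k : ℤ} (h : k * num n ≡ j [ZMOD q n]) :
    ∃ t : ℤ, ∀ z : ℂ, z / q n + k * alpha =
      (z - (k * Real.goldenConj ^ n : ℝ) + j) / (q n : ℝ) + t := by
  obtain ⟨t, ht⟩ := Int.modEq_iff_dvd.1 h
  refine ⟨-t, fun z => ?_⟩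
  have hq' : (q n : ℂ) ≠ 0 := by exact_mod_cast hq
  have h1 : (q n : ℂ) * alpha = num n - (Real.goldenConj : ℂ) ^ n := by
    exact_mod_cast congrArg (fun x : ℝ => (x : ℂ)) (q_mul_alpha n)
  have h2 : (j : ℂ) - k * num n = q n * t := by exact_mod_cast congrArg (fun x : ℤ => (x : ℂ)) ht
  have h3 : (alpha : ℂ) = (num n - (Real.goldenConj : ℂ) ^ n) / q n := by
    rw [← h1]; field_simp
  rw [h3]
  push_cast
  field_simp
  linear_combination -h2

/-- Binet's formula, with `goldenRatio * goldenConj = -1`. -/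
theorem q_mul_goldenConj_pow (n : ℕ) :
    (q n : ℝ) * Real.goldenConj ^ n = ((-1) ^ n - (Real.goldenConj ^ 2) ^ n) / √5 := by
  rw [q, Real.coe_fib_eq, div_mul_eq_mul_div, sub_mul, ← mul_pow, ← mul_pow,
    Real.goldenRatio_mul_goldenConj, ← sq]

theorem goldenConj_sq_le : Real.goldenConj ^ 2 ≤ 191 / 500 := by
  have : (2.236 : ℝ) ≤ √5 := Real.le_sqrt_of_sq_le (by norm_num)
  rw [Real.goldenConj_sq, Real.goldenConj]
  linarith

theorem abs_mul_goldenConj_pow_le {n : ℕ} {k : ℤ} (hk0 : 0 ≤ k) (hk : k ≤ q n) :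
    |k * Real.goldenConj ^ n| ≤ 31 / 50 := by
  have h1 : |k * Real.goldenConj ^ n| ≤ |q n * Real.goldenConj ^ n| := by
    rw [abs_mul, abs_mul]
    have : |(k : ℝ)| ≤ |(q n : ℝ)| := by
      rw [abs_of_nonneg (by exact_mod_cast hk0), abs_of_nonneg (by positivity)]
      exact_mod_cast hk
    gcongr
  refine h1.trans ?_
  rcases Nat.eq_zero_or_pos n with rfl | hn
  · simp [q]; norm_num
  rw [q_mul_goldenConj_pow, abs_div, abs_of_nonneg (Real.sqrt_nonneg 5)]
  have h5 : (2.236 : ℝ) ≤ √5 := Real.le_sqrt_of_sq_le (by norm_num)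
  rw [div_le_iff₀ (by linarith)]
  have h2 : |((-1 : ℝ) ^ n - (Real.goldenConj ^ 2) ^ n)| ≤ 1 + (Real.goldenConj ^ 2) ^ n := by
    refine (abs_sub _ _).trans ?_
    rw [abs_pow, abs_neg, abs_one, one_pow, abs_of_nonneg (by positivity)]
  have h3 : (Real.goldenConj ^ 2) ^ n ≤ 191 / 500 :=
    (pow_le_of_le_one (sq_nonneg _) (goldenConj_sq_le.trans (by norm_num)) hn.ne').trans
      goldenConj_sq_le
  -- For n ≥ 1 the bound is (1 + 0.382)/2.236 < 0.62.
  linarith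

/-- The radius 1/10 is chosen so that 31/50 + 1/10 = 18/25 is still below 1, the least modulus of a
nonzero integer. -/
theorem norm_sub_mul_goldenConj_pow_le {n : ℕ} {k : ℤ} (hk0 : 0 ≤ k) (hk : k ≤ q n) {z : ℂ}
    (hz : ‖z‖ < 1 / 10) : ‖z - (k * Real.goldenConj ^ n : ℝ)‖ ≤ 18 / 25 := by
  have h1 := abs_mul_goldenConj_pow_le hk0 hk
  have h2 := norm_sub_le z (k * Real.goldenConj ^ n : ℝ)
  rw [Complex.norm_real, Real.norm_eq_abs] at h2
  linarith

/-- The points `z / q_n + k α` stay away from the integers. -/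
theorem arg_ne_int {n k : ℕ} (hk : 1 ≤ k) (hkq : k < q n) {z : ℂ} (hz : ‖z‖ < 1 / 10) (m : ℤ) :
    z / q n + k * alpha ≠ m := by
  intro h
  obtain ⟨t, ht⟩ := arg_eq_of_modEq (n := n) (j := k * num n) (k := k) (by omega) rfl
  have h1 := ht z
  rw [Int.cast_natCast, h] at h1
  have hq' : ((q n : ℝ) : ℂ) ≠ 0 := by exact_mod_cast (by omega : q n ≠ 0)
  have h2 : z - (k * Real.goldenConj ^ n : ℝ) = ((q n * (m - t) - k * num n : ℤ) : ℂ) := by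
    field_simp at h1
    push_cast at h1 ⊢
    linear_combination -h1
  have h3 := norm_sub_mul_goldenConj_pow_le (n := n) (k := k) (by omega) (by omega) hz
  rw [Int.cast_natCast, h2, Complex.norm_intCast] at h3
  -- An integer of modulus at most 18/25 is 0. Hence `q n` divides k * `num n`, and by coprimality k
  -- itself, which is impossible for 1 ≤ k < `q n`.
  have h4 : (q n * (m - t) - k * num n : ℤ) = 0 := by
    by_contra h0
    have : (1 : ℝ) ≤ |((q n * (m - t) - k * num n : ℤ) : ℝ)| := by
      exact_mod_cast Int.one_le_abs h0
    linarith
  have h5 : (q n : ℤ) ∣ (-1) ^ n * num n * k :=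
    ⟨(-1) ^ n * (m - t), by linear_combination (-(-1) ^ n) * h4⟩
  have h6 := (isCoprime_num n).symm.dvd_of_dvd_mul_left h5
  have := Int.le_of_dvd (by omega) h6
  omega

/-! ### The complex sums in symmetric form -/

/-- The holomorphic extension of `sigmaN n`. -/
noncomputable def sigmaC (n : ℕ) (z : ℂ) : ℂ :=
  1 / (q n : ℂ) * ∑ k ∈ Finset.Ico 1 (q n), Complex.cot (Real.pi * (z / q n + k * alpha))

/-- The residue `k` modulo `q_n` with `k * num n ≡ j`. -/
noncomputable def index (n : ℕ) (j : ℤ) : ℤ := ((-1) ^ n * num n * j) % q n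

theorem index_nonneg {n : ℕ} (hq : 0 < q n) (j : ℤ) : 0 ≤ index n j :=
  Int.emod_nonneg _ (by omega)

theorem index_le {n : ℕ} (hq : 0 < q n) (j : ℤ) : index n j ≤ q n :=
  (Int.emod_lt_of_pos _ (by omega)).le

theorem index_mul_num (n : ℕ) (j : ℤ) : index n j * num n ≡ j [ZMOD q n] := by
  have h1 : index n j ≡ (-1) ^ n * num n * j [ZMOD q n] := Int.mod_modEq _ _
  have h2 := (num_mul_num_modEq n).mul_right j
  have h3 := h1.mul_right (num n)
  rw [one_mul] at h2
  refine h3.trans ?_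
  rwa [mul_right_comm] at h2

/-- The summand of `sigmaC n` with `k ≡ index n j`. -/
noncomputable def summand (n : ℕ) (z : ℂ) (j : ℤ) : ℂ :=
  Complex.cot (Real.pi * ((z - (index n j * Real.goldenConj ^ n : ℝ) + j) / (q n : ℝ)))

theorem cot_index {n : ℕ} (hq : 0 < q n) (z : ℂ) (j : ℤ) :
    Complex.cot (Real.pi * (z / q n + index n j * alpha)) = summand n z j := by
  obtain ⟨t, ht⟩ := arg_eq_of_modEq hq.ne' (index_mul_num n j)
  rw [ht, cot_pi_mul_add_int, summand]

/-- The average of the two reindexings by c and -c. It pairs j with -j even though the range (-q/2,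
q/2] is not symmetric for even q. -/
theorem sigmaC_eq_sum {n : ℕ} (hq : 0 < q n) (z : ℂ) :
    sigmaC n z = ∑ j ∈ residues (q n),
      1 / 2 * (1 / (q n : ℂ) * (summand n z j + summand n z (-j))) := by
  have h1 := sum_residues hq (isCoprime_num n)
    fun k => Complex.cot (Real.pi * (z / q n + k * alpha))
  have h2 := sum_residues hq (isCoprime_num n).neg_left
    fun k => Complex.cot (Real.pi * (z / q n + k * alpha))
  have h3 (j : ℤ) : (-((-1) ^ n * num n) * j) % q n = index n (-j) := by rw [index]; ring_nf
  have h4 (j : ℤ) : ((-1) ^ n * num n * j) % q n = index n j := rfl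
  simp only [h3, h4, cot_index hq, Int.cast_natCast] at h1 h2
  rw [sigmaC, ← Finset.mul_sum, ← Finset.mul_sum, Finset.sum_add_distrib, h1, h2]
  ring

theorem mem_residues {m : ℕ} {j : ℤ} :
    j ∈ residues m ↔ j ≠ 0 ∧ (m : ℤ) / 2 - m < j ∧ j ≤ (m : ℤ) / 2 := by
  rw [residues, Finset.mem_erase, Finset.mem_Ioc]

theorem norm_summand_add_le {n : ℕ} (hq : 10 ≤ q n) {z : ℂ} (hz : ‖z‖ < 1 / 10) {j : ℤ}
    (hj : j ∈ residues (q n)) :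
    ‖1 / 2 * (1 / (q n : ℂ) * (summand n z j + summand n z (-j)))‖ ≤ 1000 * (1 / (j : ℝ) ^ 2) := by
  rw [mem_residues] at hj
  have hq0 : 0 < q n := by omega
  have hjq : 2 * |(j : ℝ)| ≤ q n := by
    have : 2 * |j| ≤ q n := by
      rcases abs_cases j with h | h <;> omega
    exact_mod_cast this
  have := norm_cot_add_cot_le (q := q n) (by exact_mod_cast hq) hj.1 hjq
    (norm_sub_mul_goldenConj_pow_le (index_nonneg hq0 j) (index_le hq0 j) hz)
    (norm_sub_mul_goldenConj_pow_le (index_nonneg hq0 (-j)) (index_le hq0 (-j)) hz)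
  rw [norm_mul]
  refine le_trans (mul_le_of_le_one_left (norm_nonneg _) (by norm_num)) ?_
  simpa only [summand, Complex.ofReal_natCast] using this

theorem sigmaC_eq_tsum {n : ℕ} (hq : 0 < q n) (z : ℂ) :
    sigmaC n z = ∑' j : ℤ, if j ∈ residues (q n) then
      1 / 2 * (1 / (q n : ℂ) * (summand n z j + summand n z (-j))) else 0 := by
  rw [sigmaC_eq_sum hq, tsum_eq_sum (s := residues (q n)) fun j hj => if_neg hj]
  exact Finset.sum_congr rfl fun j hj => (if_pos hj).symm

/-! ### The limit function and dominated convergence -/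

/-- The summand of the limit function with sign `s = ±1`. -/
noncomputable def limitSummand (s : ℤ) (z : ℂ) (j : ℤ) : ℂ :=
  1 / (Real.pi * (z - (s / √5 * Int.fract (s * (j * alpha)) : ℝ) + j))

/-- The limit function with sign `s = ±1`. -/
noncomputable def limitC (s : ℤ) (z : ℂ) : ℂ :=
  ∑' j : ℤ, if j = 0 then 0 else 1 / 2 * (limitSummand s z j + limitSummand s z (-j))

theorem summable_bound : Summable fun j : ℤ => (1000 : ℝ) * (1 / (j : ℝ) ^ 2) :=
  (Real.summable_one_div_int_pow.2 one_lt_two).mul_left 1000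

theorem norm_sigmaC_le {n : ℕ} (hq : 10 ≤ q n) {z : ℂ} (hz : ‖z‖ < 1 / 10) :
    ‖sigmaC n z‖ ≤ ∑' j : ℤ, (1000 : ℝ) * (1 / (j : ℝ) ^ 2) := by
  rw [sigmaC_eq_sum (by omega)]
  refine (norm_sum_le_of_le _ fun j hj => norm_summand_add_le hq hz hj).trans ?_
  exact summable_bound.sum_le_tsum _ fun j _ => by positivity

theorem differentiableOn_sigmaC (n : ℕ) :
    DifferentiableOn ℂ (sigmaC n) (Metric.ball 0 (1 / 10)) := by
  refine (DifferentiableOn.fun_sum fun k hk => ?_).const_mul _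
  intro z hz
  rw [Finset.mem_Ico] at hk
  rw [mem_ball_zero_iff] at hz
  refine DifferentiableAt.differentiableWithinAt ?_
  have hs : Complex.sin (Real.pi * (z / q n + k * alpha)) ≠ 0 := fun h0 => by
    obtain ⟨m, hm⟩ := Complex.sin_eq_zero_iff.1 h0
    have hπ : (Real.pi : ℂ) ≠ 0 := by exact_mod_cast Real.pi_ne_zero
    rw [mul_comm] at hm
    exact arg_ne_int hk.1 hk.2 hz m (mul_right_cancel₀ hπ hm)
  have : (fun z : ℂ => Complex.cot (Real.pi * (z / q n + k * alpha))) = fun z : ℂ =>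
      Complex.cos (Real.pi * (z / q n + k * alpha)) /
        Complex.sin (Real.pi * (z / q n + k * alpha)) :=
    funext fun z => Complex.cot_eq_cos_div_sin _
  rw [this]
  exact DifferentiableAt.fun_div (by fun_prop) (by fun_prop) hs

theorem tendsto_q : Tendsto q atTop atTop := by
  refine tendsto_atTop_mono' atTop ?_ tendsto_id
  filter_upwards [eventually_ge_atTop 5] with n hn using Nat.le_fib_self hn

theorem tendsto_num_div_q : Tendsto (fun n => (num n : ℝ) / q n) atTop (𝓝 alpha) := by
  have h1 : Tendsto (fun n => Real.goldenConj ^ n) atTop (𝓝 0) := by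
    refine tendsto_pow_atTop_nhds_zero_of_abs_lt_one ?_
    rw [← sq_lt_one_iff_abs_lt_one]
    exact goldenConj_sq_le.trans_lt (by norm_num)
  have hq : Tendsto (fun n => (q n : ℝ)) atTop atTop := tendsto_natCast_atTop_atTop.comp tendsto_q
  have h2 := (h1.div_atTop hq).const_add alpha
  rw [add_zero] at h2
  refine h2.congr' ?_
  filter_upwards [tendsto_q.eventually_gt_atTop 0] with n hn
  have : (q n : ℝ) ≠ 0 := by exact_mod_cast hn.ne'
  field_simp
  linarith [q_mul_alpha n]

theorem index_eq {n : ℕ} (h : 0 < q n) (j : ℤ) :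
    (index n j : ℝ) = q n * Int.fract ((-1) ^ n * (j * ((num n : ℝ) / q n))) := by
  have h1 := Int.fract_div_intCast_eq_div_intCast_mod (k := ℝ) (m := (-1) ^ n * num n * j) (n := q n)
  have hq : (q n : ℝ) ≠ 0 := by positivity
  have h2 : (-1 : ℝ) ^ n * (j * ((num n : ℝ) / q n)) = (((-1) ^ n * num n * j : ℤ) : ℝ) / q n := by
    push_cast; ring
  rw [h2, h1, mul_div_cancel₀ _ hq, index]

/-- Along the indices of parity `i`, the sign `(-1) ^ n` is constant. -/
theorem neg_one_pow_two_mul_add (R : Type*) [Ring R] (n i : ℕ) :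
    (-1 : R) ^ (2 * n + i) = (-1) ^ i := by
  rw [pow_add, pow_mul]; simp

theorem mul_alpha_ne_int {j : ℤ} (hj : j ≠ 0) {s : ℤ} (hs : s ≠ 0) (m : ℤ) :
    (s : ℝ) * (j * alpha) ≠ m := by
  have := alpha_irrational.intCast_mul (mul_ne_zero hs hj)
  rw [Int.cast_mul, mul_assoc] at this
  exact this.ne_int m

theorem tendsto_two_mul_add (i : ℕ) : Tendsto (fun n : ℕ => 2 * n + i) atTop atTop :=
  tendsto_atTop_mono (fun n => by simp only [id]; omega) tendsto_id

/-- The product splits as (`q n` * `goldenConj ^ n`) * (`index n j` / `q n`). The first factor tends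
to (-1)^i/√5 by Binet, the second is a fractional part; irrationality of `alpha` keeps its limit
point off the jumps of `Int.fract`. -/
theorem tendsto_index_mul (i : ℕ) {j : ℤ} (hj : j ≠ 0) :
    Tendsto (fun n : ℕ => index (2 * n + i) j * Real.goldenConj ^ (2 * n + i)) atTop
      (𝓝 (((-1) ^ i : ℤ) / √5 * Int.fract (((-1) ^ i : ℤ) * (j * alpha)))) := by
  have h1 : Tendsto (fun n => (Real.goldenConj ^ 2) ^ n) atTop (𝓝 0) :=
    tendsto_pow_atTop_nhds_zero_of_lt_one (sq_nonneg _) (goldenConj_sq_le.trans_lt (by norm_num))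
  have h2 := ((h1.comp (tendsto_two_mul_add i)).const_sub ((-1 : ℝ) ^ i)).div_const √5
  rw [sub_zero] at h2
  have h3 : Tendsto (fun n : ℕ => Int.fract ((((-1) ^ i : ℤ) : ℝ) *
      (j * ((num (2 * n + i) : ℝ) / q (2 * n + i))))) atTop
      (𝓝 (Int.fract ((((-1) ^ i : ℤ) : ℝ) * (j * alpha)))) := by
    refine (continuousAt_fract (mul_alpha_ne_int hj (by simp) _)).tendsto.comp ?_
    exact ((tendsto_num_div_q.comp (tendsto_two_mul_add i)).const_mul _).const_mul _
  push_cast at h3 ⊢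
  refine (h2.mul h3).congr' ?_
  filter_upwards [(tendsto_q.comp (tendsto_two_mul_add i)).eventually_gt_atTop 0] with n hn
  rw [index_eq hn, neg_one_pow_two_mul_add, mul_right_comm, q_mul_goldenConj_pow,
    neg_one_pow_two_mul_add]
  rfl

/-- The bound 18/25 passes to the limit of the shifted points, and |j| ≥ 1 exceeds it. -/
theorem limit_arg_ne_zero {i : ℕ} {z : ℂ} (hz : ‖z‖ < 1 / 10) {j : ℤ} (hj : j ≠ 0) :
    z - ((((-1) ^ i : ℤ) / √5 * Int.fract (((-1) ^ i : ℤ) * (j * alpha)) : ℝ) : ℂ) + j ≠ 0 := by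
  intro h0
  have hlim := ((Complex.continuous_ofReal.tendsto _).comp
    (tendsto_index_mul i hj)).const_sub z |>.norm
  have h1 := le_of_tendsto hlim (b := 18 / 25) <| by
    filter_upwards [(tendsto_q.comp (tendsto_two_mul_add i)).eventually_gt_atTop 0] with n hn
    exact norm_sub_mul_goldenConj_pow_le (index_nonneg hn j) (index_le hn j) hz
  rw [eq_neg_of_add_eq_zero_left h0, norm_neg, Complex.norm_intCast] at h1
  have : (1 : ℝ) ≤ |(j : ℝ)| := by exact_mod_cast Int.one_le_abs hj
  linarith

theorem tendsto_summand (i : ℕ) {z : ℂ} (hz : ‖z‖ < 1 / 10) {j : ℤ} (hj : j ≠ 0) :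
    Tendsto (fun n : ℕ => 1 / (q (2 * n + i) : ℂ) * summand (2 * n + i) z j) atTop
      (𝓝 (limitSummand ((-1) ^ i) z j)) := by
  have hq : Tendsto (fun n => (q (2 * n + i) : ℝ)) atTop atTop :=
    tendsto_natCast_atTop_atTop.comp (tendsto_q.comp (tendsto_two_mul_add i))
  have hw := (((Complex.continuous_ofReal.tendsto _).comp
    (tendsto_index_mul i hj)).const_sub z).add_const (j : ℂ)
  exact tendsto_cot_div hq hw (limit_arg_ne_zero hz hj)

theorem eventually_mem_residues (i : ℕ) {j : ℤ} (hj : j ≠ 0) :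
    ∀ᶠ n in atTop, j ∈ residues (q (2 * n + i)) := by
  filter_upwards [(tendsto_q.comp (tendsto_two_mul_add i)).eventually_gt_atTop
    (2 * j.natAbs + 2)] with n hn
  simp only [Function.comp_apply] at hn
  rw [mem_residues]
  omega

theorem eventually_ten_le_q (i : ℕ) : ∀ᶠ n in atTop, 10 ≤ q (2 * n + i) :=
  (tendsto_q.comp (tendsto_two_mul_add i)).eventually_ge_atTop 10

theorem tendsto_sigmaC (i : ℕ) {z : ℂ} (hz : ‖z‖ < 1 / 10) :
    Tendsto (fun n : ℕ => sigmaC (2 * n + i) z) atTop (𝓝 (limitC ((-1) ^ i) z)) := by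
  have key := tendsto_tsum_of_dominated_convergence (𝓕 := atTop)
    (f := fun (n : ℕ) (j : ℤ) => if j ∈ residues (q (2 * n + i)) then
      1 / 2 * (1 / (q (2 * n + i) : ℂ) * (summand (2 * n + i) z j + summand (2 * n + i) z (-j)))
      else 0)
    (g := fun j : ℤ => if j = 0 then 0 else
      1 / 2 * (limitSummand ((-1) ^ i) z j + limitSummand ((-1) ^ i) z (-j)))
    summable_bound ?_ ?_
  · refine key.congr' ?_
    filter_upwards [eventually_ten_le_q i] with n hn
    exact (sigmaC_eq_tsum (by omega) z).symm
  · intro j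
    by_cases hj : j = 0
    · simp [hj, mem_residues]
    · simp only [if_neg hj]
      refine (((tendsto_summand i hz hj).add
        (tendsto_summand i hz (neg_ne_zero.2 hj))).const_mul (1 / 2)).congr' ?_
      filter_upwards [eventually_mem_residues i hj] with n hn
      rw [if_pos hn, mul_add (1 / (q (2 * n + i) : ℂ))]
  · filter_upwards [eventually_ten_le_q i] with n hn j
    split_ifs with h
    · exact norm_summand_add_le hn hz h
    · rw [norm_zero]; positivity

theorem tendstoLocallyUniformlyOn_sigmaC (i : ℕ) :
    TendstoLocallyUniformlyOn (fun n : ℕ => sigmaC (2 * n + i)) (limitC ((-1) ^ i)) atTop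
      (Metric.ball 0 (1 / 10)) := by
  refine tendstoLocallyUniformlyOn_of_bounded (M := ∑' j : ℤ, (1000 : ℝ) * (1 / (j : ℝ) ^ 2))
    Metric.isOpen_ball
    (fun n => differentiableOn_sigmaC _) ?_ fun z hz => tendsto_sigmaC i (by simpa using hz)
  filter_upwards [eventually_ten_le_q i] with n hn z hz
  exact norm_sigmaC_le hn (by simpa using hz)

theorem differentiableOn_limitC (i : ℕ) :
    DifferentiableOn ℂ (limitC ((-1) ^ i)) (Metric.ball 0 (1 / 10)) :=
  (tendstoLocallyUniformlyOn_sigmaC i).differentiableOn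
    (Eventually.of_forall fun _ => differentiableOn_sigmaC _) Metric.isOpen_ball

/-! ### Return to the real line -/

theorem sigmaC_ofReal (n : ℕ) (y : ℝ) : sigmaC n y = sigmaN n y := by
  rw [sigmaC, sigmaN]
  push_cast [g]
  rfl

theorem limitSummand_neg (z : ℂ) (j : ℤ) :
    limitSummand (-1) z j = -limitSummand 1 (-z) (-j) := by
  rw [limitSummand, limitSummand, ← one_div_neg_eq_neg_one_div]
  push_cast
  ring_nf

/-- The change (z, j, s) to (-z, -j, -s) keeps s * j, hence the fractional part, and reverses the
sign of the denominator. Each pair {j, -j} is preserved, so the identity holds term by term. -/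
theorem limitC_neg (z : ℂ) : limitC (-1) z = -limitC 1 (-z) := by
  rw [limitC, limitC, ← tsum_neg]
  refine tsum_congr fun j => ?_
  split_ifs
  · simp
  · rw [limitSummand_neg, limitSummand_neg, neg_neg]; ring

theorem limitC_ofReal (i : ℕ) {y : ℝ} (hy : |y| < 1 / 10) :
    limitC ((-1) ^ i) y = ((limitC ((-1) ^ i) y).re : ℝ) := by
  have h := tendsto_sigmaC i (z := y) (by simpa using hy)
  have h2 := (Complex.continuous_ofReal.tendsto _).comp ((Complex.continuous_re.tendsto _).comp h)
  refine tendsto_nhds_unique h (h2.congr fun n => ?_)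
  simp [sigmaC_ofReal]

theorem contDiffAt_g {x : ℝ} (hx : ∀ m : ℤ, x ≠ m) (l : ℕ) : ContDiffAt ℝ l g x := by
  have hs : Real.sin (Real.pi * x) ≠ 0 := fun h0 => by
    obtain ⟨m, hm⟩ := Real.sin_eq_zero_iff.1 h0
    rw [mul_comm] at hm
    exact hx m (mul_left_cancel₀ Real.pi_ne_zero hm.symm)
  have : g = fun x => Real.cos (Real.pi * x) / Real.sin (Real.pi * x) :=
    funext fun x => Real.cot_eq_cos_div_sin _
  rw [this]
  exact ContDiffAt.fun_div (by fun_prop) (by fun_prop) hs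

theorem real_arg_ne_int {n k : ℕ} (hk : 1 ≤ k) (hkq : k < q n) {y : ℝ} (hy : |y| < 1 / 10)
    (m : ℤ) : y / q n + k * alpha ≠ m := by
  intro h
  exact arg_ne_int hk hkq (z := y) (by simpa using hy) m (by exact_mod_cast congrArg Complex.ofReal h)

theorem iteratedDeriv_sigmaN (l n : ℕ) {y : ℝ} (hy : |y| < 1 / 10) :
    iteratedDeriv l (sigmaN n) y = sigmaDerivN l n y := by
  have h1 : sigmaN n = (1 / (q n : ℝ)) • fun y =>
      ∑ k ∈ Finset.Ico 1 (q n), g ((q n : ℝ)⁻¹ * y + k * alpha) := by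
    funext y
    simp [sigmaN, div_eq_inv_mul]
  rw [h1, iteratedDeriv_const_smul_field, iteratedDeriv_fun_sum]
  · simp only [iteratedDeriv_comp_mul_add, sigmaDerivN, smul_eq_mul, ← Finset.mul_sum,
      div_eq_inv_mul (y : ℝ)]
    rw [pow_succ, one_div, one_div, mul_inv, inv_pow]
    ring
  · intro k hk
    rw [Finset.mem_Ico] at hk
    have := real_arg_ne_int hk.1 hk.2 hy
    rw [div_eq_inv_mul] at this
    exact (contDiffAt_g this l).fun_comp y (by fun_prop)

/-- The limit of `sigmaN` along the indices of parity `i`. -/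
noncomputable def sigmaLimit (i : ℕ) (y : ℝ) : ℝ := (limitC ((-1) ^ i) y).re

theorem ofReal_mem_ball {y : ℝ} : (y : ℂ) ∈ Metric.ball (0 : ℂ) (1 / 10) ↔ |y| < 1 / 10 := by
  simp

theorem iteratedDeriv_limitC (i l : ℕ) {y : ℝ} (hy : |y| < 1 / 10) :
    iteratedDeriv l (limitC ((-1) ^ i)) y = (iteratedDeriv l (sigmaLimit i) y : ℝ) :=
  iteratedDeriv_ofReal_eq Metric.isOpen_ball (differentiableOn_limitC i)
    (fun _ hx => limitC_ofReal i (ofReal_mem_ball.1 hx)) l y (ofReal_mem_ball.2 hy)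

theorem tendsto_sigmaDerivN (i l : ℕ) {y : ℝ} (hy : |y| < 1 / 10) :
    Tendsto (fun n : ℕ => sigmaDerivN l (2 * n + i) y) atTop
      (𝓝 (iteratedDeriv l (sigmaLimit i) y)) := by
  have h := (tendstoLocallyUniformlyOn_iteratedDeriv Metric.isOpen_ball
    (fun n => differentiableOn_sigmaC (2 * n + i)) (tendstoLocallyUniformlyOn_sigmaC i)
    l).tendsto_at (ofReal_mem_ball.2 hy)
  rw [iteratedDeriv_limitC i l hy] at h
  refine ((Complex.continuous_re.tendsto _).comp h).congr fun n => ?_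
  rw [← iteratedDeriv_sigmaN l _ hy, Function.comp_apply,
    iteratedDeriv_ofReal_eq Metric.isOpen_ball (differentiableOn_sigmaC (2 * n + i))
      (fun x _ => sigmaC_ofReal _ x) l y (ofReal_mem_ball.2 hy), Complex.ofReal_re]

theorem analyticOnNhd_sigmaLimit (i : ℕ) :
    AnalyticOnNhd ℝ (sigmaLimit i) {y : ℝ | |y| < 1 / 10} := by
  intro y hy
  have h1 : AnalyticAt ℝ (limitC ((-1) ^ i)) y :=
    ((differentiableOn_limitC i).analyticOnNhd Metric.isOpen_ball y
      (ofReal_mem_ball.2 hy)).restrictScalars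
  have h2 : AnalyticAt ℝ (fun x : ℝ => limitC ((-1) ^ i) x) y :=
    h1.comp (Complex.ofRealCLM.analyticAt y)
  exact (Complex.reCLM.analyticAt _).comp h2

/-- Real analyticity alone would give only a local expansion; holomorphy on the disc gives
convergence on the whole interval. -/
theorem hasSum_sigmaLimit (i : ℕ) {y : ℝ} (hy : |y| < 1 / 10) :
    HasSum (fun l : ℕ => iteratedDeriv l (sigmaLimit i) 0 * y ^ l / (Nat.factorial l : ℝ))
      (sigmaLimit i y) := by
  have h := Complex.hasSum_taylorSeries_on_ball (differentiableOn_limitC i) (ofReal_mem_ball.2 hy)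
  have h0 (l : ℕ) := iteratedDeriv_limitC i l (y := 0) (by norm_num)
  rw [Complex.ofReal_zero] at h0
  rw [limitC_ofReal i hy] at h
  simp only [h0] at h
  rw [← Complex.hasSum_ofReal]
  refine h.congr_fun ?_
  intro l
  simp only [sub_zero, smul_eq_mul]
  push_cast
  ring

end GoldenCot

/-- `σ 0` and `σ 1` are the limit functions along the even and the odd indices. -/
theorem mainTheorem2 :
    ∃ r : ℝ, 0 < r ∧
      -- no summand is evaluated at a pole of `g`
      (∀ n k : ℕ, 1 ≤ k → k < GoldenCot.q n → ∀ y : ℝ, |y| < r → ∀ m : ℤ,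
        y / GoldenCot.q n + k * GoldenCot.alpha ≠ m) ∧
      ∃ σ : Fin 2 → ℝ → ℝ,
        (∀ i : Fin 2,
          (∀ y : ℝ, |y| < r →
            Tendsto (fun n : ℕ => GoldenCot.sigmaN (2 * n + (i : ℕ)) y) atTop (𝓝 (σ i y))) ∧
          AnalyticOnNhd ℝ (σ i) {y : ℝ | |y| < r} ∧
          (∀ (l : ℕ) (y : ℝ), |y| < r →
            Tendsto (fun n : ℕ => GoldenCot.sigmaDerivN l (2 * n + (i : ℕ)) y) atTop
              (𝓝 (iteratedDeriv l (σ i) y))) ∧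
          (∃ a : ℕ → ℝ,
            (∀ l : ℕ, Tendsto (fun n : ℕ => GoldenCot.sigmaDerivN l (2 * n + (i : ℕ)) 0) atTop
              (𝓝 (a l))) ∧
            ∀ y : ℝ, |y| < r →
              HasSum (fun l : ℕ => a l * y ^ l / (Nat.factorial l : ℝ)) (σ i y))) ∧
        (∀ y : ℝ, |y| < r → σ 1 y = -σ 0 (-y)) := by
  open GoldenCot in
  refine ⟨1 / 10, by norm_num, fun n k hk hkq y hy m => real_arg_ne_int hk hkq hy m,
    fun i => sigmaLimit i, fun i => ⟨fun y hy => ?_, analyticOnNhd_sigmaLimit i,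
      fun l y hy => tendsto_sigmaDerivN i l hy,
      fun l => iteratedDeriv l (sigmaLimit i) 0,
      fun l => tendsto_sigmaDerivN i l (by norm_num), fun y hy => hasSum_sigmaLimit i hy⟩,
    fun y _ => ?_⟩
  · simpa [← iteratedDeriv_sigmaN 0 _ hy] using tendsto_sigmaDerivN i 0 hy
  · simp [sigmaLimit, limitC_neg]
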